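/- Let $n,k\ge 0$ be integers and let $\mathbb{T}^n=(\mathbb{R}/\mathbb{Z})^n$ carry its flat Riemannian metric, with covering projection $\pi:\mathbb{R}^n\to\mathbb{T}^n$. A submanifold $N\subset\mathbb{T}^n$ is called regular if it is embedded; it is totally geodesic if for every $p\in N$ and every $v\in T_pN\subset\mathbb{R}^n$ the geodesic $t\mapsto p+\pi(tv)$ of $\mathbb{T}^n$ lies in $N$ for all sufficiently small $|t|$, and a totally geodesic $N$ is complete if these geodesics lie in $N$ for all $t\in\mathbb{R}$. Connected sets are non-empty. A matrix $A\in\mathbb{Z}^{k\times n}$ is called unimodular if the greatest common divisor of its $k\times k$ minors is $1$ (for $k=0$ the only minor is $1$; for $k>n$ there are none and $A$ is not unimodular). A $d$-dimensional subtorus of $\mathbb{T}^n$ is a translate of the image of an injective continuous homomorphism $\mathbb{T}^d\to\mathbb{T}^n$. (a) Every complete, regular, connected, totally geodesic submanifold $N\subset\mathbb{T}^n$ of codimension $k$ is an $(n-k)$-dimensional subtorus, and there are a unimodular $A\in\mathbb{Z}^{k\times n}$ and $c\in[0,1)^k$ such that $$N=\{x\in\mathbb{T}^n: Ax=c \bmod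 1\}.$$ (b) Conversely, for every unimodular $A\in\mathbb{Z}^{k\times n}$ and every $c\in[0,1)^k$, the set $\{x\in\mathbb{T}^n: Ax=c\bmod 1\}$ is a complete, regular, connected, totally geodesic submanifold of $\mathbb{T}^n$ of codimension $k$ and an $(n-k)$-dimensional subtorus. -/

import Mathlib

open scoped ContDiff Topology

noncomputable section

namespace FlatTorus

/-- Euclidean space `ℝⁿ`, the universal cover of the flat torus `𝕋ⁿ = (ℝ/ℤ)ⁿ`, which is Mathlib's
`UnitAddTorus (Fin n)`. -/
abbrev Cover (n : ℕ) : Type := EuclideanSpace ℝ (Fin n)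

/-- The covering projection `π : ℝⁿ → 𝕋ⁿ`, `x ↦ x mod 1`. The smooth structure and the flat metric
of `𝕋ⁿ` are those for which `π` is a local isometry; in particular the differential of `π`
identifies every tangent space of `𝕋ⁿ` with `ℝⁿ`. -/
def proj {n : ℕ} (x : Cover n) : UnitAddTorus (Fin n) := fun i => (x i : UnitAddCircle)

/-- `N ⊆ 𝕋ⁿ` is a regular (that is, embedded) smooth submanifold of codimension `k`: around each of
its points there is a smooth chart of `𝕋ⁿ` in which `N` is the locus where the first `k` coordinates
vanish. A chart of `𝕋ⁿ` is given here as `Φ ∘ (π|_W)⁻¹`, where `W = Φ.source` is an open subset of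
`ℝⁿ` on which `π` is injective and `Φ` is a diffeomorphism from `W` onto an open subset
of `ℝⁿ`. -/
def IsRegularSubmanifold {n : ℕ} (k : ℕ) (N : Set (UnitAddTorus (Fin n))) : Prop :=
  k ≤ n ∧ ∀ x : Cover n, proj x ∈ N →
    ∃ Φ : OpenPartialHomeomorph (Cover n) (Cover n),
      x ∈ Φ.source ∧ Set.InjOn proj Φ.source ∧
      ContDiffOn ℝ ∞ Φ Φ.source ∧ ContDiffOn ℝ ∞ Φ.symm Φ.target ∧
      ∀ y ∈ Φ.source, proj y ∈ N ↔ ∀ i : Fin n, (i : ℕ) < k → Φ y i = 0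

/-- The vectors tangent to `N` at `π x`: velocities at time `0` of smooth curves in `N` through
`π x`. A curve in `𝕋ⁿ` through `π x` is given by its lift `γ` to `ℝⁿ` with `γ 0 = x`. -/
def tangentVectors {n : ℕ} (N : Set (UnitAddTorus (Fin n))) (x : Cover n) : Set (Cover n) :=
  {v | ∃ γ : ℝ → Cover n, ContDiffAt ℝ ∞ γ 0 ∧ γ 0 = x ∧ deriv γ 0 = v ∧
    ∀ᶠ t in 𝓝 (0 : ℝ), proj (γ t) ∈ N}

/-- `γ : ℝ → ℝⁿ` is the lift of a geodesic `π ∘ γ` of the flat torus: it solves the geodesic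
equation `γ'' = 0` (the Christoffel symbols vanish in the standard coordinates). -/
def IsGeodesicLift {n : ℕ} (γ : ℝ → Cover n) : Prop :=
  ContDiff ℝ ∞ γ ∧ ∀ t, deriv (deriv γ) t = 0

/-- `N` is totally geodesic: a geodesic of `𝕋ⁿ` that starts at a point of `N` in a direction tangent
to `N` lies in `N` for all sufficiently small times. -/
def IsTotallyGeodesic {n : ℕ} (N : Set (UnitAddTorus (Fin n))) : Prop :=
  ∀ γ : ℝ → Cover n, IsGeodesicLift γ → proj (γ 0) ∈ N → deriv γ 0 ∈ tangentVectors N (γ 0) →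
    ∀ᶠ t in 𝓝 (0 : ℝ), proj (γ t) ∈ N

/-- Completeness of a totally geodesic `N`: a geodesic of `𝕋ⁿ` that lies in `N` for all sufficiently
small times lies in `N` for all times. (For totally geodesic `N` these are, for small times,
exactly the geodesics of `N`.) -/
def IsGeodesicallyComplete {n : ℕ} (N : Set (UnitAddTorus (Fin n))) : Prop :=
  ∀ γ : ℝ → Cover n, IsGeodesicLift γ → (∀ᶠ t in 𝓝 (0 : ℝ), proj (γ t) ∈ N) →
    ∀ t, proj (γ t) ∈ N

/-- `N` is a `d`-dimensional subtorus of `𝕋ⁿ`: a translate of the image of an injective continuous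
(hence, `𝕋ᵈ` being a compact Lie group, smooth and embedding) homomorphism `𝕋ᵈ → 𝕋ⁿ`. -/
def IsSubtorus {n : ℕ} (d : ℕ) (N : Set (UnitAddTorus (Fin n))) : Prop :=
  ∃ (f : UnitAddTorus (Fin d) →+ UnitAddTorus (Fin n)) (p : UnitAddTorus (Fin n)),
    Continuous f ∧ Function.Injective f ∧ N = Set.range fun y => p + f y

/-- An integer `k × n` matrix is unimodular if the greatest common divisor of all its `k × k` minors
is `1`. A minor is given by an increasing choice `s` of `k` columns; there is none if `k > n`, and
then the matrix is not unimodular. -/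
def IsUnimodular {k n : ℕ} (A : Matrix (Fin k) (Fin n) ℤ) : Prop :=
  (Finset.univ : Finset (Fin k ↪o Fin n)).gcd (fun s => (A.submatrix id s).det) = 1

/-- The set `{x ∈ 𝕋ⁿ : A x = c}`, the equation being one in `𝕋ᵏ`, i.e. modulo `1`. -/
def resonanceSet {k n : ℕ} (A : Matrix (Fin k) (Fin n) ℤ) (c : Fin k → ℝ) :
    Set (UnitAddTorus (Fin n)) :=
  {x | ∀ i, ∑ j, A i j • x j = (c i : UnitAddCircle)}

end FlatTorus

end

/-! Unimodularity of `A` is equivalent to a right inverse over `ℤ`: Cramer's rule and Bézout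
coefficients for the minors give one direction, reduction modulo a prime the other. A right inverse
splits `ℤⁿ` as `ker A ⊕ B ℤᵏ` (`exists_splitting`). So resonance sets are translated tori, and the
rows of `A` extend to a linear chart.

For (a), let the tangent space of `N` at `π x` be `ker L`. Completeness puts `π (x + ker L)` inside
`N`, and near `x` embeddedness leaves room for this one sheet only
(`IsRegularSubmanifold.exists_tangent_map`). Hence `L (ℤⁿ)` is discrete, as short nonzero vectors of
it would produce further sheets. It is thus a lattice in `ℝᵏ`, and `L` in a lattice basis is an
integer matrix `A` with right inverse (`exists_realMap_ker_eq`). The resonance set of `A` through `π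
x` is exactly `π (x + ker L)`; it is closed, and open in `N`, so it is all of the connected `N`. -/

namespace FlatTorus

noncomputable section

open Matrix

/-! ### Unimodular matrices and splittings of `ℤⁿ` -/

/-- A unimodular integer matrix has a right inverse. -/
theorem IsUnimodular.exists_mul_eq_one {k n : ℕ} {A : Matrix (Fin k) (Fin n) ℤ}
    (hA : IsUnimodular A) : ∃ B : Matrix (Fin n) (Fin k) ℤ, A * B = 1 := by
  classical
  obtain ⟨g, hg⟩ := Finset.gcd_eq_sum_mul (Finset.univ : Finset (Fin k ↪o Fin n))
    (fun s => (A.submatrix id s).det)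
  have h1 : Finset.univ.gcd (fun s : Fin k ↪o Fin n => (A.submatrix id s).det) = 1 := hA
  rw [h1] at hg
  let S : (Fin k ↪o Fin n) → Matrix (Fin n) (Fin k) ℤ := fun s =>
    (1 : Matrix (Fin n) (Fin n) ℤ).submatrix id s
  have hS : ∀ s, A * S s = A.submatrix id s := by
    intro s
    ext i j
    simp [S, Matrix.mul_apply, Matrix.one_apply]
  -- Each adjugate contributes its minor times the identity; the Bézout coefficients `g` make these
  -- sum to `1`.
  refine ⟨∑ s, g s • (S s * (A.submatrix id s).adjugate), ?_⟩
  rw [Matrix.mul_sum]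
  simp_rw [Matrix.mul_smul, ← Matrix.mul_assoc, hS, Matrix.mul_adjugate, smul_smul]
  rw [← Finset.sum_smul]
  have : ∑ s, g s * (A.submatrix id s).det = 1 := by
    rw [hg]
    exact Finset.sum_congr rfl fun s _ => by ring
  rw [this, one_smul]

/-- Over a field, a matrix with a right inverse has an invertible maximal minor. -/
theorem exists_det_submatrix_ne_zero {F : Type*} [Field F] {k n : ℕ}
    {A : Matrix (Fin k) (Fin n) F} {B : Matrix (Fin n) (Fin k) F} (h : A * B = 1) :
    ∃ s : Fin k ↪o Fin n, (A.submatrix id s).det ≠ 0 := by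
  classical
  obtain ⟨κ, a, ha, hsp, hli⟩ := exists_linearIndependent' F A.col
  have htop : Submodule.span F (Set.range A.col) = ⊤ := by
    rw [← Matrix.range_mulVecLin, LinearMap.range_eq_top]
    intro y
    refine ⟨B *ᵥ y, ?_⟩
    simp [h]
  have : Fintype κ := Fintype.ofInjective a ha
  have hcard : Fintype.card κ = k := by
    have b := Module.Basis.mk hli (by rw [hsp, htop])
    have := Module.finrank_eq_card_basis b
    simpa using this.symm
  -- `a` lists the basis columns in no particular order, whereas minors use increasing choices; `e`
  -- below records the reordering.
  have hs : (Finset.univ.image a).card = k := by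
    rw [Finset.card_image_of_injective _ ha, Finset.card_univ, hcard]
  refine ⟨(Finset.univ.image a).orderEmbOfFin hs, ?_⟩
  have hmem : ∀ i, ∃ x, a x = (Finset.univ.image a).orderEmbOfFin hs i := by
    intro i
    simpa only [Finset.mem_image, Finset.mem_univ, true_and] using
      Finset.orderEmbOfFin_mem (Finset.univ.image a) hs i
  choose e he using hmem
  have einj : Function.Injective e := by
    intro i j hij
    have := he i
    rw [hij, he j] at this
    exact ((Finset.univ.image a).orderEmbOfFin hs).injective this.symm
  have hli' : LinearIndependent F
      (A.submatrix id ((Finset.univ.image a).orderEmbOfFin hs)).col := by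
    have hcol : (A.submatrix id ((Finset.univ.image a).orderEmbOfFin hs)).col =
        (A.col ∘ a) ∘ e := by
      ext i j
      simp [Matrix.col_apply, he]
    rw [hcol]
    exact hli.comp e einj
  rw [Matrix.linearIndependent_cols_iff_isUnit, Matrix.isUnit_iff_isUnit_det] at hli'
  exact hli'.ne_zero

/-- An integer matrix with a right inverse is unimodular. -/
theorem isUnimodular_of_mul_eq_one {k n : ℕ} {A : Matrix (Fin k) (Fin n) ℤ}
    {B : Matrix (Fin n) (Fin k) ℤ} (h : A * B = 1) : IsUnimodular A := by
  classical
  unfold IsUnimodular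
  set g := Finset.univ.gcd (fun s : Fin k ↪o Fin n => (A.submatrix id s).det) with hg
  have hnorm : normalize g = g := Finset.normalize_gcd
  by_contra hne
  have hna : g.natAbs ≠ 1 := by
    intro h1
    apply hne
    have := Int.nonneg_of_normalize_eq_self hnorm
    omega
  -- Modulo `p` all maximal minors vanish, but the right inverse survives. The case `g = 0` is
  -- included.
  obtain ⟨p, hp, hpg⟩ := Nat.exists_prime_and_dvd hna
  have := Fact.mk hp
  have hmap : A.map (Int.castRingHom (ZMod p)) * B.map (Int.castRingHom (ZMod p)) = 1 := by
    rw [← Matrix.map_mul, h]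
    simp
  obtain ⟨s, hs⟩ := exists_det_submatrix_ne_zero hmap
  apply hs
  have hd : (p : ℤ) ∣ (A.submatrix id s).det :=
    (Int.natCast_dvd.2 hpg).trans (Finset.gcd_dvd (Finset.mem_univ s))
  have : (A.map (Int.castRingHom (ZMod p))).submatrix id s =
      (Int.castRingHom (ZMod p)).mapMatrix (A.submatrix id s) := rfl
  rw [this, ← RingHom.map_det]
  simpa using (ZMod.intCast_zmod_eq_zero_iff_dvd _ p).2 hd

/-- A right-invertible integer matrix is the projection onto a factor of a splitting
`ℤⁿ ≅ ℤⁿ⁻ᵏ × ℤᵏ`. -/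
theorem exists_splitting {k n : ℕ} {A : Matrix (Fin k) (Fin n) ℤ}
    {B : Matrix (Fin n) (Fin k) ℤ} (h : A * B = 1) :
    k ≤ n ∧ ∃ (K : Matrix (Fin n) (Fin (n - k)) ℤ) (C : Matrix (Fin (n - k)) (Fin n) ℤ),
      A * K = 0 ∧ C * K = 1 ∧ K * C + B * A = 1 := by
  classical
  have hsurj : Function.Surjective A.mulVecLin := fun y => ⟨B *ᵥ y, by simp [h]⟩
  have hrank := Submodule.finrank_quotient_add_finrank (LinearMap.ker A.mulVecLin)
  rw [(A.mulVecLin.quotKerEquivOfSurjective hsurj).finrank_eq] at hrank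
  simp only [Module.finrank_fintype_fun_eq_card, Fintype.card_fin] at hrank
  refine ⟨by omega, ?_⟩
  have hker : Module.finrank ℤ (LinearMap.ker A.mulVecLin) = n - k := by omega
  let b := Module.finBasisOfFinrankEq ℤ (LinearMap.ker A.mulVecLin) hker
  -- `1 - B * A` projects onto the kernel along the image of `B`; `K` holds a kernel basis and `C`
  -- the coordinates of this projection.
  have hP : ∀ x, (1 - B * A) *ᵥ x ∈ LinearMap.ker A.mulVecLin := by
    intro x
    simp [Matrix.mul_sub, ← Matrix.mul_assoc, h]
  let K : Matrix (Fin n) (Fin (n - k)) ℤ := Matrix.of fun i j => (b j : Fin n → ℤ) i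
  let P : (Fin n → ℤ) →ₗ[ℤ] LinearMap.ker A.mulVecLin :=
    LinearMap.codRestrict _ (1 - B * A).mulVecLin hP
  let C : Matrix (Fin (n - k)) (Fin n) ℤ := LinearMap.toMatrix' (b.equivFun.toLinearMap ∘ₗ P)
  have hC : ∀ x, C *ᵥ x = b.equivFun (P x) := by
    intro x
    rw [← Matrix.toLin'_apply, Matrix.toLin'_toMatrix']
    rfl
  have hK : ∀ y, K *ᵥ y = (b.equivFun.symm y : Fin n → ℤ) := by
    intro y
    ext i
    simp [K, Matrix.mulVec, dotProduct, Module.Basis.equivFun_symm_apply, mul_comm]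
  have hKC : K * C = 1 - B * A := by
    apply Matrix.mulVec_injective
    ext1 x
    rw [← Matrix.mulVec_mulVec, hC, hK, LinearEquiv.symm_apply_apply]
    rfl
  have hAK : A * K = 0 := by
    apply Matrix.mulVec_injective
    ext1 x
    rw [← Matrix.mulVec_mulVec, hK]
    have := LinearMap.mem_ker.1 (b.equivFun.symm x).2
    rw [mulVecLin_apply] at this
    rw [this, zero_mulVec]
  refine ⟨K, C, hAK, ?_, by rw [hKC]; abel⟩
  apply Matrix.mulVec_injective
  ext1 x
  rw [← Matrix.mulVec_mulVec, hC, one_mulVec]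
  have : P (K *ᵥ x) = b.equivFun.symm x := by
    apply Subtype.ext
    rw [← hK]
    change (1 - B * A) *ᵥ (K *ᵥ x) = _
    rw [Matrix.mulVec_mulVec, Matrix.sub_mul, Matrix.mul_assoc, hAK]
    simp
  rw [this, LinearEquiv.apply_symm_apply]

/-! ### Torus homomorphisms and resonance sets as subtori -/

variable {k n : ℕ}

/-- The homomorphism `𝕋ⁿ → 𝕋ᵏ` given by an integer matrix. -/
def torusMap (A : Matrix (Fin k) (Fin n) ℤ) :
    UnitAddTorus (Fin n) →+ UnitAddTorus (Fin k) where
  toFun x i := ∑ j, A i j • x j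
  map_zero' := by ext; simp
  map_add' x y := by ext; simp [Finset.sum_add_distrib]

theorem torusMap_apply (A : Matrix (Fin k) (Fin n) ℤ) (x : UnitAddTorus (Fin n)) (i : Fin k) :
    torusMap A x i = ∑ j, A i j • x j := rfl

theorem torusMap_torusMap {l : ℕ} (A : Matrix (Fin l) (Fin k) ℤ) (B : Matrix (Fin k) (Fin n) ℤ)
    (x : UnitAddTorus (Fin n)) : torusMap A (torusMap B x) = torusMap (A * B) x := by
  ext i
  simp only [torusMap_apply, Matrix.mul_apply, Finset.smul_sum, Finset.sum_smul, mul_smul]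
  exact Finset.sum_comm

theorem torusMap_one (x : UnitAddTorus (Fin n)) : torusMap 1 x = x := by
  ext i
  simp [torusMap_apply, Matrix.one_apply]

theorem torusMap_zero (x : UnitAddTorus (Fin n)) :
    torusMap (0 : Matrix (Fin k) (Fin n) ℤ) x = 0 := by
  ext i
  simp [torusMap_apply]

theorem torusMap_add (A B : Matrix (Fin k) (Fin n) ℤ) (x : UnitAddTorus (Fin n)) :
    torusMap (A + B) x = torusMap A x + torusMap B x := by
  ext i
  simp [torusMap_apply, add_smul, Finset.sum_add_distrib]

theorem continuous_torusMap (A : Matrix (Fin k) (Fin n) ℤ) : Continuous (torusMap A) := by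
  refine continuous_pi fun i => ?_
  change Continuous fun x : UnitAddTorus (Fin n) => ∑ j, A i j • x j
  fun_prop

theorem mem_resonanceSet {A : Matrix (Fin k) (Fin n) ℤ} {c : Fin k → ℝ}
    {x : UnitAddTorus (Fin n)} :
    x ∈ resonanceSet A c ↔ torusMap A x = fun i => (c i : UnitAddCircle) :=
  funext_iff.symm

theorem isClosed_resonanceSet (A : Matrix (Fin k) (Fin n) ℤ) (c : Fin k → ℝ) :
    IsClosed (resonanceSet A c) := by
  have : resonanceSet A c = torusMap A ⁻¹' {fun i => (c i : UnitAddCircle)} := by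
    ext x
    exact mem_resonanceSet
  rw [this]
  exact isClosed_singleton.preimage (continuous_torusMap A)

/-- For a right-invertible integer matrix, a resonance set is a parametrized subtorus. -/
theorem exists_resonanceSet_eq_range {A : Matrix (Fin k) (Fin n) ℤ}
    {B : Matrix (Fin n) (Fin k) ℤ} (h : A * B = 1) (c : Fin k → ℝ) :
    ∃ (f : UnitAddTorus (Fin (n - k)) →+ UnitAddTorus (Fin n)) (p : UnitAddTorus (Fin n)),
      Continuous f ∧ Function.Injective f ∧ resonanceSet A c = Set.range fun y => p + f y := by
  obtain ⟨-, K, C, hAK, hCK, hKC⟩ := exists_splitting h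
  refine ⟨torusMap K, torusMap B fun i => (c i : UnitAddCircle), continuous_torusMap K, ?_, ?_⟩
  · intro x y hxy
    have := congrArg (torusMap C) hxy
    rwa [torusMap_torusMap, torusMap_torusMap, hCK, torusMap_one, torusMap_one] at this
  · ext x
    rw [mem_resonanceSet]
    constructor
    · intro hx
      refine ⟨torusMap C x, ?_⟩
      dsimp only
      rw [← hx, torusMap_torusMap, torusMap_torusMap, add_comm, ← torusMap_add, hKC, torusMap_one]
    · rintro ⟨y, rfl⟩
      dsimp only
      rw [map_add, torusMap_torusMap, torusMap_torusMap, h, hAK, torusMap_one, torusMap_zero,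
        add_zero]

theorem isSubtorus_resonanceSet {A : Matrix (Fin k) (Fin n) ℤ} (hA : IsUnimodular A)
    (c : Fin k → ℝ) : IsSubtorus (n - k) (resonanceSet A c) :=
  let ⟨_, h⟩ := hA.exists_mul_eq_one
  exists_resonanceSet_eq_range h c

theorem IsSubtorus.isConnected {d : ℕ} {N : Set (UnitAddTorus (Fin n))} (hN : IsSubtorus d N) :
    IsConnected N := by
  obtain ⟨f, p, hf, -, rfl⟩ := hN
  exact isConnected_range (by fun_prop)

/-! ### The covering projection and lifted resonance equations -/

theorem proj_surjective : Function.Surjective (proj : Cover n → UnitAddTorus (Fin n)) := by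
  intro q
  choose x hx using fun i => QuotientAddGroup.mk_surjective (q i)
  exact ⟨WithLp.toLp 2 x, funext hx⟩

theorem isOpenMap_proj : IsOpenMap (proj : Cover n → UnitAddTorus (Fin n)) := by
  have h1 : IsOpenMap (Pi.map fun _ : Fin n => ((↑) : ℝ → UnitAddCircle)) :=
    IsOpenMap.piMap (fun _ => QuotientAddGroup.isOpenMap_coe)
      (Filter.Eventually.of_forall fun _ => QuotientAddGroup.mk_surjective)
  exact h1.comp (PiLp.homeomorph 2 fun _ : Fin n => ℝ).isOpenMap

theorem unitAddCircle_coe_eq_coe_iff {a b : ℝ} :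
    (a : UnitAddCircle) = b ↔ ∃ m : ℤ, a = b + m := by
  rw [← sub_eq_zero, ← AddCircle.coe_sub, AddCircle.coe_eq_zero_iff]
  refine exists_congr fun m => ?_
  rw [zsmul_one, eq_sub_iff_add_eq, eq_comm, add_comm]

theorem proj_eq_proj_iff {x y : Cover n} :
    proj x = proj y ↔ ∃ m : Fin n → ℤ, ∀ i, x i = y i + m i := by
  rw [funext_iff]
  simp only [proj, unitAddCircle_coe_eq_coe_iff]
  exact Classical.skolem

/-- The linear map `ℝⁿ → ℝᵏ` given by an integer matrix. -/
def realMap (A : Matrix (Fin k) (Fin n) ℤ) : Cover n →L[ℝ] (Fin k → ℝ) :=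
  LinearMap.toContinuousLinearMap
    ((A.map ((↑) : ℤ → ℝ)).mulVecLin ∘ₗ (WithLp.linearEquiv 2 ℝ (Fin n → ℝ)).toLinearMap)

theorem realMap_apply (A : Matrix (Fin k) (Fin n) ℤ) (x : Cover n) (i : Fin k) :
    realMap A x i = ∑ j, (A i j : ℝ) * x j := rfl

theorem torusMap_proj (A : Matrix (Fin k) (Fin n) ℤ) (x : Cover n) (i : Fin k) :
    torusMap A (proj x) i = (realMap A x i : UnitAddCircle) := by
  rw [realMap_apply, torusMap_apply]
  have : ∀ j, (A i j : ℝ) * x j = A i j • x j := fun j => (zsmul_eq_mul _ _).symm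
  simp_rw [this]
  exact (map_sum (QuotientAddGroup.mk' (AddSubgroup.zmultiples (1 : ℝ)))
    (fun j => A i j • x j) Finset.univ).symm

theorem proj_mem_resonanceSet {A : Matrix (Fin k) (Fin n) ℤ} {c : Fin k → ℝ} {x : Cover n} :
    proj x ∈ resonanceSet A c ↔ ∃ m : Fin k → ℤ, ∀ i, realMap A x i = c i + m i := by
  rw [mem_resonanceSet, funext_iff]
  simp only [torusMap_proj, unitAddCircle_coe_eq_coe_iff]
  exact Classical.skolem

/-- Two lifted solutions differ by an integer vector under `A`, and an integer of absolute value
below `1` is `0`. Locally the set is therefore a single affine plane. -/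
theorem proj_mem_resonanceSet_iff_of_near {A : Matrix (Fin k) (Fin n) ℤ} {c : Fin k → ℝ}
    {x y : Cover n} (hx : proj x ∈ resonanceSet A c) (h : ∀ i, |realMap A (y - x) i| < 1) :
    proj y ∈ resonanceSet A c ↔ realMap A (y - x) = 0 := by
  obtain ⟨m, hm⟩ := proj_mem_resonanceSet.1 hx
  rw [proj_mem_resonanceSet]
  constructor
  · rintro ⟨l, hl⟩
    ext i
    have hi := h i
    have : realMap A (y - x) i = ((l i - m i : ℤ) : ℝ) := by
      rw [map_sub, Pi.sub_apply, hl, hm]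
      push_cast
      ring
    rw [this] at hi ⊢
    have h0 : |l i - m i| < 1 := by exact_mod_cast hi
    rw [Int.abs_lt_one_iff.1 h0]
    simp
  · intro h0
    rw [map_sub, sub_eq_zero] at h0
    exact ⟨m, by simpa [h0] using hm⟩

theorem eventually_abs_realMap_lt (A : Matrix (Fin k) (Fin n) ℤ) (x : Cover n) :
    ∀ᶠ y in 𝓝 x, ∀ i, |realMap A (y - x) i| < 1 := by
  rw [Filter.eventually_all]
  intro i
  have : Continuous fun y => |realMap A (y - x) i| := by fun_prop
  exact this.continuousAt.eventually_lt continuousAt_const (by simp)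

/-- Along a curve in the resonance set the lifted value of `A` is locally constant. -/
theorem realMap_deriv_eq_zero {A : Matrix (Fin k) (Fin n) ℤ} {c : Fin k → ℝ}
    {γ : ℝ → Cover n} (hγ : DifferentiableAt ℝ γ 0)
    (h : ∀ᶠ t in 𝓝 (0 : ℝ), proj (γ t) ∈ resonanceSet A c) : realMap A (deriv γ 0) = 0 := by
  have h0 : proj (γ 0) ∈ resonanceSet A c := h.self_of_nhds
  have hev : (fun t => realMap A (γ t)) =ᶠ[𝓝 0] fun _ => realMap A (γ 0) := by
    filter_upwards [h, hγ.continuousAt.eventually (eventually_abs_realMap_lt A (γ 0))] with t h1 h2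
    rw [proj_mem_resonanceSet_iff_of_near h0 h2, map_sub, sub_eq_zero] at h1
    exact h1
  have hd : HasDerivAt (fun t => realMap A (γ t)) (realMap A (deriv γ 0)) 0 :=
    (realMap A).hasFDerivAt.comp_hasDerivAt 0 hγ.hasDerivAt
  rw [← hd.deriv, hev.deriv_eq, deriv_const]

/-! ### Geodesics -/

theorem IsGeodesicLift.eq_add_smul {γ : ℝ → Cover n} (hγ : IsGeodesicLift γ) (t : ℝ) :
    γ t = γ 0 + t • deriv γ 0 := by
  have hd : Differentiable ℝ γ := hγ.1.differentiable (by simp)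
  have hd' : Differentiable ℝ (deriv γ) :=
    ((contDiff_infty_iff_deriv.1 hγ.1).2).differentiable (by simp)
  have hc : ∀ s, deriv γ s = deriv γ 0 := fun s => is_const_of_deriv_eq_zero hd' hγ.2 s 0
  have hg : ∀ s, HasDerivAt (fun s => γ s - s • deriv γ 0) 0 s := by
    intro s
    have := (hd s).hasDerivAt.sub ((hasDerivAt_id s).smul_const (deriv γ 0))
    rw [hc s, one_smul, sub_self] at this
    exact this
  have := is_const_of_deriv_eq_zero (fun s => (hg s).differentiableAt) (fun s => (hg s).deriv) t 0
  simp only [zero_smul, sub_zero] at this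
  rw [← this, sub_add_cancel]

theorem isGeodesicLift_add_smul (x v : Cover n) :
    IsGeodesicLift (fun t : ℝ => x + t • v) ∧ deriv (fun t : ℝ => x + t • v) 0 = v := by
  have hd : deriv (fun t : ℝ => x + t • v) = fun _ => v := by
    ext1 t
    have := ((hasDerivAt_id t).smul_const v).const_add x
    rw [one_smul] at this
    exact this.deriv
  refine ⟨⟨by fun_prop, fun t => ?_⟩, by rw [hd]⟩
  rw [hd, deriv_const]

theorem IsGeodesicLift.mem_resonanceSet {A : Matrix (Fin k) (Fin n) ℤ} {c : Fin k → ℝ}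
    {γ : ℝ → Cover n} (hγ : IsGeodesicLift γ) (h0 : proj (γ 0) ∈ resonanceSet A c)
    (hA : realMap A (deriv γ 0) = 0) (t : ℝ) : proj (γ t) ∈ resonanceSet A c := by
  rw [proj_mem_resonanceSet] at h0 ⊢
  rwa [hγ.eq_add_smul t, map_add, map_smul, hA, smul_zero, add_zero]

theorem isGeodesicallyComplete_resonanceSet (A : Matrix (Fin k) (Fin n) ℤ) (c : Fin k → ℝ) :
    IsGeodesicallyComplete (resonanceSet A c) := fun γ hγ h =>
  hγ.mem_resonanceSet h.self_of_nhds
    (realMap_deriv_eq_zero (hγ.1.differentiable (by simp) 0) h)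

theorem isTotallyGeodesic_resonanceSet (A : Matrix (Fin k) (Fin n) ℤ) (c : Fin k → ℝ) :
    IsTotallyGeodesic (resonanceSet A c) := by
  rintro γ hγ h0 ⟨δ, hδ, -, hδγ, h⟩
  refine Filter.Eventually.of_forall (hγ.mem_resonanceSet h0 ?_)
  rw [← hδγ]
  exact realMap_deriv_eq_zero (hδ.differentiableAt (by simp)) h

/-! ### Linear charts for resonance sets -/

/-- A right-invertible integer matrix consists of the first rows of an invertible one. -/
theorem exists_equiv_extending_realMap {A : Matrix (Fin k) (Fin n) ℤ}
    {B : Matrix (Fin n) (Fin k) ℤ} (h : A * B = 1) :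
    k ≤ n ∧ ∃ E : Cover n ≃L[ℝ] Cover n,
      ∀ y (i : Fin n) (hi : (i : ℕ) < k), E y i = realMap A y ⟨i, hi⟩ := by
  obtain ⟨hkn, K, C, -, -, hKC⟩ := exists_splitting h
  refine ⟨hkn, ?_⟩
  let e : Fin k ⊕ Fin (n - k) ≃ Fin n := finSumFinEquiv.trans (finCongr (by omega))
  let M : Matrix (Fin n) (Fin n) ℤ := (Matrix.fromRows A C).submatrix e.symm id
  let M' : Matrix (Fin n) (Fin n) ℤ := (Matrix.fromCols B K).submatrix id e.symm
  have h1 : M' * M = 1 := by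
    rw [Matrix.submatrix_mul_equiv, Matrix.fromCols_mul_fromRows, add_comm, hKC]
    simp
  have h2 : M * M' = 1 := mul_eq_one_comm.1 h1
  let φ := Int.castRingHom ℝ
  have h1' : M'.map φ * M.map φ = 1 := by rw [← Matrix.map_mul, h1]; simp
  have h2' : M.map φ * M'.map φ = 1 := by rw [← Matrix.map_mul, h2]; simp
  let w := WithLp.linearEquiv 2 ℝ (Fin n → ℝ)
  refine ⟨(w ≪≫ₗ Matrix.toLin'OfInv h1' h2' ≪≫ₗ w.symm).toContinuousLinearEquiv, ?_⟩
  intro y i hi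
  change (M.map φ *ᵥ y.ofLp) i = ∑ j, (A ⟨i, hi⟩ j : ℝ) * y j
  have he : e.symm i = Sum.inl ⟨i, hi⟩ := by
    rw [Equiv.symm_apply_eq]
    rfl
  simp [Matrix.mulVec, dotProduct, M, φ, he]

theorem isRegularSubmanifold_resonanceSet {A : Matrix (Fin k) (Fin n) ℤ} (hA : IsUnimodular A)
    (c : Fin k → ℝ) : IsRegularSubmanifold k (resonanceSet A c) := by
  obtain ⟨B, hB⟩ := hA.exists_mul_eq_one
  obtain ⟨hkn, E, hE⟩ := exists_equiv_extending_realMap hB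
  refine ⟨hkn, fun x hx => ?_⟩
  -- With the bound `1 / 2`, coordinates of two points of the chart differ by less than `1`, so
  -- `proj` is injective there.
  have hcoord : ∀ᶠ y in 𝓝 x, ∀ j, |y j - x j| < 1 / 2 := by
    rw [Filter.eventually_all]
    intro j
    have : Continuous fun y : Cover n => |y j - x j| := by fun_prop
    exact this.continuousAt.eventually_lt continuousAt_const (by simp)
  obtain ⟨s, hs, hso, hxs⟩ :=
    eventually_nhds_iff.1 (hcoord.and (eventually_abs_realMap_lt A x))
  let Φ := ((Homeomorph.subRight x).trans E.toHomeomorph).toOpenPartialHomeomorph.restr s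
  have hsource : Φ.source = s := by simp [Φ, hso.interior_eq]
  refine ⟨Φ, by rwa [hsource], ?_, ?_, ?_, ?_⟩
  · rw [hsource]
    intro y hy z hz hyz
    obtain ⟨m, hm⟩ := proj_eq_proj_iff.1 hyz
    ext i
    have h1 := (hs y hy).1 i
    have h2 := (hs z hz).1 i
    have h3 : |(m i : ℝ)| < 1 := by
      have : (m i : ℝ) = (y i - x i) - (z i - x i) := by rw [hm i]; ring
      rw [this]
      exact (abs_sub _ _).trans_lt (by linarith)
    have h4 : m i = 0 := Int.abs_lt_one_iff.1 (by exact_mod_cast h3)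
    simp [hm i, h4]
  · have : ContDiff ℝ ∞ fun y => E (y - x) := by fun_prop
    exact this.contDiffOn
  · have : ContDiff ℝ ∞ fun y => E.symm y + x := by fun_prop
    exact this.contDiffOn
  · intro y hy
    rw [hsource] at hy
    rw [proj_mem_resonanceSet_iff_of_near hx (hs y hy).2]
    change _ ↔ ∀ i : Fin n, (i : ℕ) < k → E (y - x) i = 0
    constructor
    · intro h i hi
      rw [hE _ i hi, h]
      rfl
    · intro h
      ext i
      have := h (Fin.castLE hkn i) i.2
      rwa [hE _ _ i.2] at this

/-! ### Tangent spaces of regular submanifolds -/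

/-- At each of its points, a regular submanifold has a tangent space, the kernel of a surjective
linear map; if the submanifold contains the tangent plane, it locally coincides with it. -/
theorem IsRegularSubmanifold.exists_tangent_map {N : Set (UnitAddTorus (Fin n))}
    (hN : IsRegularSubmanifold k N) {x : Cover n} (hx : proj x ∈ N) :
    ∃ L : Cover n →L[ℝ] (Fin k → ℝ), Function.Surjective L ∧
      tangentVectors N x = {v | L v = 0} ∧
      ((∀ v, L v = 0 → proj (x + v) ∈ N) → ∀ᶠ y in 𝓝 x, proj y ∈ N → L (y - x) = 0) := by
  obtain ⟨hkn, hN⟩ := hN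
  obtain ⟨Φ, hxΦ, -, hsm, hsm', hΦN⟩ := hN x hx
  let pr : Cover n →L[ℝ] (Fin k → ℝ) :=
    ContinuousLinearMap.pi fun i => EuclideanSpace.proj (Fin.castLE hkn i)
  have hpr : ∀ y ∈ Φ.source, proj y ∈ N ↔ pr (Φ y) = 0 := by
    intro y hy
    rw [hΦN y hy, funext_iff]
    exact ⟨fun h i => h (Fin.castLE hkn i) i.2, fun h i hi => h ⟨i, hi⟩⟩
  have hsource : Φ.source ∈ 𝓝 x := Φ.open_source.mem_nhds hxΦ
  have htarget : Φ.target ∈ 𝓝 (Φ x) := Φ.open_target.mem_nhds (Φ.map_source hxΦ)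
  have hcd : ContDiffAt ℝ ∞ Φ x := hsm.contDiffAt hsource
  have hcd' : ContDiffAt ℝ ∞ Φ.symm (Φ x) := hsm'.contDiffAt htarget
  have hD : HasFDerivAt Φ (fderiv ℝ Φ x) x := (hcd.differentiableAt (by simp)).hasFDerivAt
  have hD' : HasFDerivAt Φ.symm (fderiv ℝ Φ.symm (Φ x)) (Φ x) :=
    (hcd'.differentiableAt (by simp)).hasFDerivAt
  set D := fderiv ℝ Φ x
  set D' := fderiv ℝ Φ.symm (Φ x)
  have hD'D : ∀ v, D' (D v) = v := by
    have h1 : HasFDerivAt (fun y => Φ.symm (Φ y)) (D'.comp D) x := hD'.comp x hD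
    have h2 : HasFDerivAt (fun y => Φ.symm (Φ y)) (ContinuousLinearMap.id ℝ (Cover n)) x :=
      (hasFDerivAt_id x).congr_of_eventuallyEq
        (Filter.eventually_of_mem hsource fun y hy => Φ.left_inv hy)
    exact fun v => DFunLike.congr_fun (h1.unique h2) v
  have hDD' : ∀ v, D (D' v) = v := by
    have hinj : Function.Injective D := Function.LeftInverse.injective hD'D
    have hsurj := (LinearMap.injective_iff_surjective (f := (D : Cover n →ₗ[ℝ] Cover n))).1 hinj
    intro v
    obtain ⟨w, rfl⟩ := hsurj v
    exact congrArg D (hD'D w)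
  have hprsurj : Function.Surjective pr := by
    intro u
    refine ⟨WithLp.toLp 2 fun i => if h : (i : ℕ) < k then u ⟨i, h⟩ else 0, ?_⟩
    ext i
    simp [pr]
  have hprx : pr (Φ x) = 0 := (hpr x hxΦ).1 hx
  let L : Cover n →L[ℝ] (Fin k → ℝ) := pr.comp D
  have hLsurj : Function.Surjective L := hprsurj.comp (Function.RightInverse.surjective hDD')
  refine ⟨L, hLsurj, ?_, ?_⟩
  · ext v
    constructor
    · rintro ⟨γ, hγ, rfl, rfl, hγN⟩
      have hγd := (hγ.differentiableAt (by simp)).hasDerivAt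
      have h1 : HasDerivAt (fun t => pr (Φ (γ t))) (L (deriv γ 0)) 0 :=
        pr.hasFDerivAt.comp_hasDerivAt 0 (hD.comp_hasDerivAt 0 hγd)
      have h2 : (fun t => pr (Φ (γ t))) =ᶠ[𝓝 0] fun _ => 0 := by
        filter_upwards [hγN, hγd.continuousAt hsource] with t ht ht'
        exact (hpr _ ht').1 ht
      change L _ = 0
      rw [← h1.deriv, h2.deriv_eq, deriv_const]
    · intro hv
      have hline := (isGeodesicLift_add_smul (Φ x) (D v))
      have hlined : HasDerivAt (fun t : ℝ => Φ x + t • D v) (D v) 0 := by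
        have := (hline.1.1.differentiable (by simp) 0).hasDerivAt
        rwa [hline.2] at this
      have hline0 : Φ x + (0 : ℝ) • D v = Φ x := by simp
      -- A straight line in the chart, pulled back: it stays where the first `k` coordinates vanish.
      refine ⟨fun t => Φ.symm (Φ x + t • D v), ?_, ?_, ?_, ?_⟩
      · refine ContDiffAt.comp (g := Φ.symm) 0 ?_ hline.1.1.contDiffAt
        rwa [hline0]
      · simp [Φ.left_inv hxΦ]
      · have : HasDerivAt (fun t : ℝ => Φ.symm (Φ x + t • D v)) (D' (D v)) 0 := by
          refine HasFDerivAt.comp_hasDerivAt (l := Φ.symm) 0 ?_ hlined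
          rwa [hline0]
        rw [this.deriv, hD'D]
      · have hc : Filter.Tendsto (fun t : ℝ => Φ x + t • D v) (𝓝 0) (𝓝 (Φ x)) := by
          have := hlined.continuousAt.tendsto
          rwa [hline0] at this
        filter_upwards [hc htarget] with t ht
        rw [hpr _ (Φ.map_target ht), Φ.right_inv ht, map_add, map_smul, hprx]
        have : pr (D v) = 0 := hv
        rw [this, smul_zero, add_zero]
  · intro hplane
    obtain ⟨R, hR⟩ := LinearMap.exists_rightInverse_of_surjective
      (L : Cover n →ₗ[ℝ] (Fin k → ℝ)) (LinearMap.range_eq_top.2 hLsurj)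
    let R' : (Fin k → ℝ) →L[ℝ] Cover n := LinearMap.toContinuousLinearMap R
    have hR' : ∀ u, L (R' u) = u := fun u => DFunLike.congr_fun hR u
    have hstrict : HasStrictFDerivAt (fun y => pr (Φ y)) L x :=
      pr.hasStrictFDerivAt.comp x (hcd.hasStrictFDerivAt (by simp))
    -- Compare `y` with its projection `q y` to the tangent plane. Both are zeros of `pr ∘ Φ`, so
    -- strict differentiability bounds `‖L (y - x)‖` by this constant times `‖R' (L (y - x))‖`,
    -- hence by half of itself.
    have hε : 0 < 1 / (2 * (‖R'‖ + 1)) := by positivity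
    have hlo := hstrict.isLittleO.def hε
    let q : Cover n → Cover n := fun y => y - R' (L (y - x))
    have hqx : q x = x := by simp [q]
    have hq : Filter.Tendsto q (𝓝 x) (𝓝 x) := by
      have : Continuous q := by fun_prop
      have := this.tendsto x
      rwa [hqx] at this
    have hpair : Filter.Tendsto (fun y => (y, q y)) (𝓝 x) (𝓝 (x, x)) :=
      Filter.tendsto_id.prodMk_nhds hq
    filter_upwards [hpair.eventually hlo, hsource, hq hsource] with y hy hys hqs hyN
    have h1 : pr (Φ y) = 0 := (hpr y hys).1 hyN
    have h2 : pr (Φ (q y)) = 0 := by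
      refine (hpr _ hqs).1 ?_
      have := hplane (q y - x) (by
        have : q y - x = (y - x) - R' (L (y - x)) := by simp only [q]; abel
        rw [this, map_sub, hR', sub_self])
      rwa [add_sub_cancel] at this
    have h3 : y - q y = R' (L (y - x)) := by simp [q]
    simp only [h1, h2, h3, hR', sub_self, zero_sub, norm_neg] at hy
    have h4 := R'.le_opNorm (L (y - x))
    have h5 : ‖L (y - x)‖ ≤ 1 / 2 * ‖L (y - x)‖ := by
      refine hy.trans ?_
      calc 1 / (2 * (‖R'‖ + 1)) * ‖R' (L (y - x))‖
          ≤ 1 / (2 * (‖R'‖ + 1)) * ((‖R'‖ + 1) * ‖L (y - x)‖) := by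
            gcongr
            exact h4.trans (by gcongr; linarith)
        _ = 1 / 2 * ‖L (y - x)‖ := by field_simp
    exact norm_le_zero_iff.1 (by linarith)

/-- The tangent plane at a point of a complete totally geodesic set lies in the set. -/
theorem IsTotallyGeodesic.proj_add_mem {N : Set (UnitAddTorus (Fin n))}
    (hg : IsTotallyGeodesic N) (hc : IsGeodesicallyComplete N) {x v : Cover n}
    (hx : proj x ∈ N) (hv : v ∈ tangentVectors N x) : proj (x + v) ∈ N := by
  obtain ⟨h1, h2⟩ := isGeodesicLift_add_smul x v
  have h3 := hc _ h1 (hg _ h1 (by simpa using hx) (by rw [h2]; simpa using hv)) 1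
  simpa using h3

/-! ### Discreteness, the integer matrix and the classification -/

/-- The inclusion `ℤⁿ → ℝⁿ`. -/
def intVec : (Fin n → ℤ) →ₗ[ℤ] Cover n :=
  AddMonoidHom.toIntLinearMap
    { toFun := fun m => WithLp.toLp 2 fun i => (m i : ℝ)
      map_zero' := by ext; simp
      map_add' := fun _ _ => by ext; simp }

theorem intVec_apply (m : Fin n → ℤ) (i : Fin n) : intVec m i = m i := rfl

theorem proj_add_intVec (x : Cover n) (m : Fin n → ℤ) : proj (x + intVec m) = proj x :=
  proj_eq_proj_iff.2 ⟨m, fun _ => rfl⟩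

theorem realMap_intVec (A : Matrix (Fin k) (Fin n) ℤ) (m : Fin n → ℤ) (i : Fin k) :
    realMap A (intVec m) i = ((A *ᵥ m) i : ℤ) := by
  simp [realMap_apply, intVec_apply, Matrix.mulVec, dotProduct]

/-- A surjective linear map `ℝⁿ → ℝᵏ` that sends `ℤⁿ` to a discrete group has the same kernel as a
right-invertible integer matrix. -/
theorem exists_realMap_ker_eq {L : Cover n →L[ℝ] (Fin k → ℝ)} (hL : Function.Surjective L)
    (hdisc : ∃ ε > 0, ∀ m : Fin n → ℤ, ‖L (intVec m)‖ < ε → L (intVec m) = 0) :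
    ∃ (A : Matrix (Fin k) (Fin n) ℤ) (B : Matrix (Fin n) (Fin k) ℤ),
      A * B = 1 ∧ ∀ x, realMap A x = 0 ↔ L x = 0 := by
  classical
  let g : (Fin n → ℤ) →ₗ[ℤ] (Fin k → ℝ) := (L.toLinearMap.restrictScalars ℤ) ∘ₗ intVec
  let Γ : Submodule ℤ (Fin k → ℝ) := LinearMap.range g
  have hdΓ : DiscreteTopology Γ := by
    obtain ⟨ε, hε, h⟩ := hdisc
    refine DiscreteTopology.of_forall_le_norm hε ?_
    rintro ⟨_, m, rfl⟩ hne
    by_contra! hlt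
    exact hne (Subtype.ext (h m hlt))
  let e := (EuclideanSpace.basisFun (Fin n) ℝ).toBasis
  have he : ∀ j, e j = intVec (Pi.single j 1) := by
    intro j
    ext i
    by_cases hij : i = j <;> simp [e, intVec_apply, hij]
  have hΓ : IsZLattice ℝ Γ := by
    refine ⟨top_le_iff.1 ?_⟩
    rw [← LinearMap.range_eq_top.2 (show Function.Surjective L.toLinearMap from hL),
      LinearMap.range_eq_map, ← e.span_eq, Submodule.map_span, Submodule.span_le]
    rintro _ ⟨_, ⟨j, rfl⟩, rfl⟩
    refine Submodule.subset_span ⟨Pi.single j 1, ?_⟩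
    rw [he]
    rfl
  let b := IsZLattice.basis Γ
  let b' := b.ofZLatticeBasis ℝ Γ
  let A : Matrix (Fin k) (Fin n) ℤ := Matrix.of fun i j => b.repr (g.rangeRestrict (Pi.single j 1)) i
  have hA : ∀ x, realMap A x = b'.equivFun (L x) := by
    have : (realMap A).toLinearMap = b'.equivFun.toLinearMap ∘ₗ L.toLinearMap := by
      refine e.ext fun j => ?_
      ext i
      have h1 : b'.repr (L (intVec (Pi.single j 1))) i = A i j :=
        b.ofZLatticeBasis_repr_apply ℝ Γ (g.rangeRestrict (Pi.single j 1)) i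
      simp [he, h1, realMap_intVec]
    exact fun x => DFunLike.congr_fun this x
  -- Integer preimages of the lattice basis form the columns of the right inverse.
  choose m hm using fun i => (b i).2
  refine ⟨A, Matrix.of fun j i => m i j, ?_, fun x => ?_⟩
  · ext i l
    have h1 := congrFun (hA (intVec (m l))) i
    have h2 : L (intVec (m l)) = b' l := (hm l).trans (b.ofZLatticeBasis_apply ℝ Γ l).symm
    rw [h2, realMap_intVec, Module.Basis.equivFun_self] at h1
    have h3 : (A * Matrix.of fun j i => m i j) i l = (A *ᵥ m l) i := rfl
    rw [h3, Matrix.one_apply]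
    simp only [eq_comm (a := l)] at h1
    exact_mod_cast h1
  · rw [hA]
    exact LinearEquiv.map_eq_zero_iff _

theorem exists_resonanceSet_eq {N : Set (UnitAddTorus (Fin n))}
    (hN : IsRegularSubmanifold k N) (hconn : IsConnected N) (hg : IsTotallyGeodesic N)
    (hc : IsGeodesicallyComplete N) :
    ∃ (A : Matrix (Fin k) (Fin n) ℤ) (c : Fin k → ℝ),
      IsUnimodular A ∧ (∀ i, c i ∈ Set.Ico (0 : ℝ) 1) ∧ N = resonanceSet A c := by
  obtain ⟨p, hp⟩ := hconn.nonempty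
  obtain ⟨x, rfl⟩ := proj_surjective p
  obtain ⟨L, hL, hT, hloc⟩ := hN.exists_tangent_map hp
  have hplane : ∀ v, L v = 0 → proj (x + v) ∈ N := fun v hv =>
    hg.proj_add_mem hc hp (by rw [hT]; exact hv)
  replace hloc := hloc hplane
  obtain ⟨R, hR⟩ := LinearMap.exists_rightInverse_of_surjective
    (L : Cover n →ₗ[ℝ] (Fin k → ℝ)) (LinearMap.range_eq_top.2 hL)
  have hR' : ∀ u, L (R u) = u := fun u => DFunLike.congr_fun hR u
  have hRc : Continuous R := LinearMap.continuous_of_finiteDimensional R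
  have hdisc : ∃ ε > 0, ∀ m : Fin n → ℤ, ‖L (intVec m)‖ < ε → L (intVec m) = 0 := by
    have ht : Filter.Tendsto (fun u => x + R u) (𝓝 0) (𝓝 x) := by
      have : Continuous fun u => x + R u := by fun_prop
      simpa using this.tendsto 0
    obtain ⟨ε, hε, h⟩ := Metric.eventually_nhds_iff.1 (ht.eventually hloc)
    refine ⟨ε, hε, fun m hm => ?_⟩
    -- Modulo `ℤⁿ`, the point `x + R (L m)` equals a point of `x + ker L`, so it lies in `N`; being
    -- close to `x`, it must lie on the plane itself.
    have h1 := h (y := L (intVec m)) (by simpa using hm) (by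
      have h2 := hplane (R (L (intVec m)) - intVec m) (by rw [map_sub, hR', sub_self])
      rw [← proj_add_intVec _ m] at h2
      rwa [add_assoc, sub_add_cancel] at h2)
    rwa [add_sub_cancel_left, hR'] at h1
  obtain ⟨A, B, hAB, hA⟩ := exists_realMap_ker_eq hL hdisc
  let c : Fin k → ℝ := fun i => Int.fract (realMap A x i)
  have hxc : realMap A x = fun i => c i + ⌊realMap A x i⌋ := by
    ext i
    exact (Int.fract_add_floor _).symm
  have hmem : ∀ y, proj y ∈ resonanceSet A c ↔ ∃ v, L v = 0 ∧ proj y = proj (x + v) := by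
    intro y
    rw [proj_mem_resonanceSet]
    constructor
    · rintro ⟨m, hm⟩
      let l : Fin k → ℤ := fun i => m i - ⌊realMap A x i⌋
      have hl : A *ᵥ (B *ᵥ l) = l := by simp [hAB]
      -- Since `A B l = l`, translating by the lattice vector `B l` absorbs the integer discrepancy
      -- `l`.
      refine ⟨y - x - intVec (B *ᵥ l), ?_, ?_⟩
      · rw [← hA]
        ext i
        rw [map_sub, map_sub, Pi.sub_apply, Pi.sub_apply, realMap_intVec, hl, hm i, hxc]
        simp [l]
      · rw [← proj_add_intVec (x + _) (B *ᵥ l)]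
        congr 1
        abel
    · rintro ⟨v, hv, hyv⟩
      rw [← proj_mem_resonanceSet, hyv, proj_mem_resonanceSet]
      refine ⟨fun i => ⌊realMap A x i⌋, fun i => ?_⟩
      rw [map_add, (hA v).2 hv, add_zero]
      exact congrFun hxc i
  have hsub : resonanceSet A c ⊆ N := by
    intro q hq
    obtain ⟨y, rfl⟩ := proj_surjective q
    obtain ⟨v, hv, hyv⟩ := (hmem y).1 hq
    rw [hyv]
    exact hplane v hv
  have hopen : ∀ q ∈ resonanceSet A c, ∀ᶠ q' in 𝓝 q, q' ∈ N → q' ∈ resonanceSet A c := by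
    intro q hq
    obtain ⟨y, rfl⟩ := proj_surjective q
    obtain ⟨v, hv, hyv⟩ := (hmem y).1 hq
    rw [hyv]
    obtain ⟨L', hL', hT', hloc'⟩ := hN.exists_tangent_map (hplane v hv)
    have hle : LinearMap.ker L.toLinearMap ≤ LinearMap.ker L'.toLinearMap := by
      intro w hw
      have hw' : L w = 0 := hw
      have : w ∈ tangentVectors N (x + v) := by
        obtain ⟨h1, h2⟩ := isGeodesicLift_add_smul (x + v) w
        refine ⟨_, h1.1.contDiffAt, by simp, h2, Filter.Eventually.of_forall fun t => ?_⟩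
        rw [add_assoc]
        exact hplane _ (by rw [map_add, map_smul, hv, hw', smul_zero, add_zero])
      rw [hT'] at this
      exact this
    -- Both kernels have codimension `k`, so the tangent plane is the same at every point of the
    -- sheet.
    have heq : LinearMap.ker L.toLinearMap = LinearMap.ker L'.toLinearMap := by
      refine Submodule.eq_of_le_of_finrank_eq hle ?_
      have h1 := LinearMap.finrank_range_add_finrank_ker L.toLinearMap
      have h2 := LinearMap.finrank_range_add_finrank_ker L'.toLinearMap
      rw [LinearMap.range_eq_top.2 hL] at h1
      rw [LinearMap.range_eq_top.2 hL'] at h2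
      omega
    have hker : ∀ w, L' w = 0 → L w = 0 := fun w hw => heq.ge hw
    have hev := hloc' fun w hw => by
      rw [add_assoc]
      exact hplane _ (by rw [map_add, hv, hker w hw, add_zero])
    have himage := isOpenMap_proj.image_mem_nhds hev
    filter_upwards [himage]
    rintro _ ⟨z, hz, rfl⟩ hzN
    refine (hmem z).2 ⟨z - x, ?_, by rw [add_sub_cancel]⟩
    have h3 : L (z - (x + v)) = 0 := hker _ (hz hzN)
    rw [← sub_sub, map_sub, hv, sub_zero] at h3
    exact h3
  have hx : proj x ∈ resonanceSet A c := (hmem x).2 ⟨0, map_zero L, by rw [add_zero]⟩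
  refine ⟨A, c, isUnimodular_of_mul_eq_one hAB,
    fun i => ⟨Int.fract_nonneg _, Int.fract_lt_one _⟩, hsub.antisymm' ?_⟩
  -- `U` and the complement of the resonance set are open, cover `N`, and do not meet inside `N`.
  let U : Set (UnitAddTorus (Fin n)) := interior {q | q ∈ N → q ∈ resonanceSet A c}
  have hU : resonanceSet A c ⊆ U := fun q hq => mem_interior_iff_mem_nhds.2 (hopen q hq)
  rcases isPreconnected_iff_subset_of_disjoint.1 hconn.isPreconnected U (resonanceSet A c)ᶜ
    isOpen_interior (isClosed_resonanceSet A c).isOpen_compl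
    (fun q _ => (em (q ∈ resonanceSet A c)).imp (fun h => hU h) id)
    (Set.eq_empty_of_forall_notMem fun q hq => hq.2.2 (interior_subset hq.2.1 hq.1)) with h | h
  · exact fun q hq => interior_subset (h hq) hq
  · exact absurd hx (h hp)

end

end FlatTorus

theorem mainTheorem4 (n k : ℕ) :
    (∀ N : Set (UnitAddTorus (Fin n)),
      FlatTorus.IsRegularSubmanifold k N → IsConnected N →
      FlatTorus.IsTotallyGeodesic N → FlatTorus.IsGeodesicallyComplete N →
        FlatTorus.IsSubtorus (n - k) N ∧
        ∃ (A : Matrix (Fin k) (Fin n) ℤ) (c : Fin k → ℝ),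
          FlatTorus.IsUnimodular A ∧ (∀ i, c i ∈ Set.Ico (0 : ℝ) 1) ∧
          N = FlatTorus.resonanceSet A c) ∧
    (∀ (A : Matrix (Fin k) (Fin n) ℤ) (c : Fin k → ℝ),
      FlatTorus.IsUnimodular A → (∀ i, c i ∈ Set.Ico (0 : ℝ) 1) →
        FlatTorus.IsRegularSubmanifold k (FlatTorus.resonanceSet A c) ∧
        IsConnected (FlatTorus.resonanceSet A c) ∧
        FlatTorus.IsTotallyGeodesic (FlatTorus.resonanceSet A c) ∧
        FlatTorus.IsGeodesicallyComplete (FlatTorus.resonanceSet A c) ∧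
        FlatTorus.IsSubtorus (n - k) (FlatTorus.resonanceSet A c)) := by
  refine ⟨fun N hN hconn hg hc => ?_, fun A c hA _ => ?_⟩
  · obtain ⟨A, c, hA, hc01, rfl⟩ := FlatTorus.exists_resonanceSet_eq hN hconn hg hc
    exact ⟨FlatTorus.isSubtorus_resonanceSet hA c, A, c, hA, hc01, rfl⟩
  · have hsub := FlatTorus.isSubtorus_resonanceSet hA c
    exact ⟨FlatTorus.isRegularSubmanifold_resonanceSet hA c, hsub.isConnected,
      FlatTorus.isTotallyGeodesic_resonanceSet A c,
      FlatTorus.isGeodesicallyComplete_resonanceSet A c, hsub⟩
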